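/- All graphs are finite and loopless, and may have parallel edges. For a graph $G$ and $S\subseteq V(G)$, let $E_G(S)$ be the set of edges of $G$ with exactly one end in $S$, and for $x\in S$ let $C_G(S,x)$ be the vertex set of the connected component of the induced subgraph $G[S]$ that contains $x$. The edge-degree of a vertex $x$ is $|E_G(\{x\})|$, and $\Delta_{\mathsf e}(G)$ denotes the maximum edge-degree of a vertex of $G$. A layout of $G$ is a linear ordering $L=\langle x_1,\dots,x_n\rangle$ of $V(G)$; put $S_i=\{x_i,\dots,x_n\}$. The edge-treewidth of $G$ is $$\mathbf{etw}(G)=\min_{L}\ \max_{1\le i\le n}\ \bigl|E_G\bigl(C_G(S_i,x_i)\bigr)\bigr|,$$ the minimum being over all layouts $L$ of $G$. Let $\mathbf{tw}$ denote treewidth. A graph is 2-connected if it is connected, has no cut vertex and has at least two edges (in particular, two vertices joined by at least two parallel edges form a 2-connected graph). A block of $G$ is either a bridge of $G$ (together with its two ends) or a maximal 2-connected subgraph of $G$. Let $$\mathbf p(G)=\max\bigl\{\mathbf{tw}(B),\ \Delta_{\mathsf e}(B)\ :\ B\text{ a block of }G\bigr\},$$ with $\mathbf p(G)=0$ if $G$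 has no edges. Then $\mathbf{etw}$ and $\mathbf p$ are parametrically equivalent, that is, there are functions $f,g:\mathbb N\to\mathbb N$ such that $\mathbf{etw}(G)\le f(\mathbf p(G))$ and $\mathbf p(G)\le g(\mathbf{etw}(G))$ for every graph $G$. Explicitly, for every graph $G$, $$\sqrt{\mathbf p(G)}\ \le\ \mathbf{etw}(G)\ \le\ \mathbf p(G)^4+2\,\mathbf p(G)^2 .$$ -/

import Mathlib

/-! Finite loopless multigraphs are terms `G : Graph α β` of Mathlib's multigraph type with
`G.vertexSet` and `G.edgeSet` finite and `G.Loopless`. -/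

universe u v

noncomputable section

namespace Graph

/-- `E_G(S)`: the set of edges with one end in `S` and the other end not in `S`. -/
def edgeBoundary {α : Type u} {β : Type v} (G : Graph α β) (S : Set α) : Set β :=
  {e | ∃ x y, G.IsLink e x y ∧ x ∈ S ∧ y ∉ S}

/-- The edge-degree `|E_G({x})|` of a vertex. -/
def edgeDegree {α : Type u} {β : Type v} (G : Graph α β) (x : α) : ℕ :=
  (G.edgeBoundary {x}).ncard

/-- The maximum edge-degree of a graph. -/
def maxEdgeDegree {α : Type u} {β : Type v} (G : Graph α β) : ℕ :=
  sSup {n | ∃ x ∈ V(G), n = G.edgeDegree x}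

/-- `x` and `y` are joined by a walk of `G`. -/
def Joined {α : Type u} {β : Type v} (G : Graph α β) (x y : α) : Prop :=
  Relation.ReflTransGen G.Adj x y

/-- `C_G(S, x)`: the vertex set of the connected component of `G[S]` that contains `x`
(for `S ⊆ V(G)` and `x ∈ S`). -/
def componentIn {α : Type u} {β : Type v} (G : Graph α β) (S : Set α) (x : α) : Set α :=
  {y | (G.induce S).Joined x y}

/-- A layout of a finite graph: an enumeration of its vertices, without repetition. -/
abbrev Layout {α : Type u} {β : Type v} (G : Graph α β) : Type u :=
  Fin V(G).ncard ≃ V(G)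

/-- `S_i`: the set of vertices at position `i` or later. -/
def Layout.tail {α : Type u} {β : Type v} {G : Graph α β} (L : G.Layout)
    (i : Fin V(G).ncard) : Set α :=
  {x | ∃ j, i ≤ j ∧ (L j : α) = x}

/-- The cost `|E_G(C_G(S_i, x_i))|` of position `i`. -/
def Layout.edgeCost {α : Type u} {β : Type v} {G : Graph α β} (L : G.Layout)
    (i : Fin V(G).ncard) : ℕ :=
  (G.edgeBoundary (G.componentIn (L.tail i) (L i))).ncard

/-- The maximum cost of a position of the layout. -/
def Layout.maxEdgeCost {α : Type u} {β : Type v} {G : Graph α β} (L : G.Layout) : ℕ :=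
  Finset.univ.sup L.edgeCost

/-- Edge-treewidth: the minimum over all layouts of the maximum cost of a position. -/
def edgeTreewidth {α : Type u} {β : Type v} (G : Graph α β) : ℕ :=
  sInf {k | ∃ L : G.Layout, k = L.maxEdgeCost}

/-- Tree decompositions of `G`, over finite trees. -/
structure TreeDecomposition {α : Type u} {β : Type v} (G : Graph α β) where
  /-- the nodes of the tree -/
  Node : Type u
  /-- there are finitely many nodes -/
  finite_node : Finite Node
  /-- the tree -/
  tree : SimpleGraph Node
  isTree : tree.IsTree
  /-- the bag of a node -/
  bag : Node → Set α
  bag_subset : ∀ t, bag t ⊆ V(G)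
  exists_mem_bag : ∀ x ∈ V(G), ∃ t, x ∈ bag t
  exists_link_bag : ∀ e x y, G.IsLink e x y → ∃ t, x ∈ bag t ∧ y ∈ bag t
  bag_connected : ∀ x ∈ V(G), (tree.induce {t | x ∈ bag t}).Preconnected

/-- Treewidth: the least `k` such that some tree decomposition has all bags of size at most
`k + 1`. -/
def treewidth {α : Type u} {β : Type v} (G : Graph α β) : ℕ :=
  sInf {k | ∃ D : G.TreeDecomposition, ∀ t, (D.bag t).ncard ≤ k + 1}

/-- Any two vertices are joined by a walk. -/
def IsPreconnected {α : Type u} {β : Type v} (G : Graph α β) : Prop :=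
  ∀ x ∈ V(G), ∀ y ∈ V(G), G.Joined x y

/-- A loopless multigraph is 2-connected if it is connected, has no cut vertex, and has at least
two edges (so two vertices joined by parallel edges, the cycle of length two in particular, count
as 2-connected, while a one-vertex graph and a single edge do not). -/
structure IsTwoConnected {α : Type u} {β : Type v} (G : Graph α β) : Prop where
  preconnected : G.IsPreconnected
  deleteVert_preconnected : ∀ x ∈ V(G), (G.deleteVerts {x}).IsPreconnected
  two_edges : E(G).Nontrivial

/-- A bridge: an edge whose removal separates its ends. -/
def IsBridge {α : Type u} {β : Type v} (G : Graph α β) (e : β) : Prop :=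
  ∃ x y, G.IsLink e x y ∧ ¬ (G.deleteEdges {e}).Joined x y

/-- A block of `G` is a bridge of `G` together with its two ends, or a maximal 2-connected subgraph
of `G`. -/
def IsBlock {α : Type u} {β : Type v} (G B : Graph α β) : Prop :=
  (∃ e x y, G.IsBridge e ∧ G.IsLink e x y ∧ B = Graph.banana x y {e}) ∨
    Maximal (fun H : Graph α β => H ≤ G ∧ H.IsTwoConnected) B

/-- The maximum of the treewidth and the maximum edge-degree of `B`, over all blocks `B` of `G`
(it is `0` if there are no blocks, that is, if `G` has no edges). -/
def blockParameter {α : Type u} {β : Type v} (G : Graph α β) : ℕ :=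
  sSup {n | ∃ B, G.IsBlock B ∧ (n = B.treewidth ∨ n = B.maxEdgeDegree)}

end Graph

/-- Functions from graphs to non-negative integers. -/
abbrev GraphParameter : Type (max (u + 1) (v + 1)) :=
  ∀ (α : Type u) (β : Type v), Graph α β → ℕ

/-- `p ≲ q`: there is a function `f` with `p(G) ≤ f(q(G))` for all finite loopless multigraphs. -/
def GraphParameter.UpperBoundedBy (p q : GraphParameter.{u, v}) : Prop :=
  ∃ f : ℕ → ℕ, ∀ (α : Type u) (β : Type v) (G : Graph α β),
    G.vertexSet.Finite → G.edgeSet.Finite → G.Loopless → p α β G ≤ f (q α β G)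

/-- Parametric equivalence of graph parameters. -/
def GraphParameter.ParametricallyEquivalent (p q : GraphParameter.{u, v}) : Prop :=
  q.UpperBoundedBy p ∧ p.UpperBoundedBy q

end

/-! Let `k` be the edge-treewidth of `G`. In an optimal layout the tail component of a vertex has at
most `k` boundary edges, hence at most `k` outer neighbours, and making the last outer neighbour of
each vertex its parent yields a tree decomposition of width at most `k`. Now let `x` be a vertex
that is not a cut vertex. If every component of the vertices after `x` has a neighbour before `x`,
each edge at `x` can be charged to one of the at most `k` boundary edges of the tail component of
`x`, at most `k` edges to each; otherwise some component of the vertices after `x` consists of all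
vertices but `x`, and its boundary contains the edges at `x`. As layouts restrict to subgraphs
without increasing costs, this bounds the block parameter by `k ^ 2`.

Conversely, order the vertices of a block by their depth in a rooted tree decomposition. The outer
neighbours of each tail component then lie in one bag, so the cost is at most the width times the
maximum edge-degree. The root can be chosen such that a prescribed vertex comes first, which allows
gluing layouts along a cut vertex: list one side, then the rest of the other side in an order that
starts with the cut vertex. No cost increases, so all blocks can be combined in this way. -/

namespace EdgeTreewidth

open Graph

variable {α : Type u} {β : Type v} {G H : Graph α β} {S T : Set α} {x y a b : α} {e : β}
  {f : α → ℕ} {k m n : ℕ}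

lemma ncard_le_mul_of_subset_biUnion {ι ε : Type*} {s : Set ε} {t : Set ι} {F : ι → Set ε}
    (ht : t.Finite) (hF : ∀ i ∈ t, (F i).Finite) (hs : s ⊆ ⋃ i ∈ t, F i)
    (hn : ∀ i ∈ t, (F i).ncard ≤ n) : s.ncard ≤ t.ncard * n := by
  calc s.ncard ≤ (⋃ i ∈ t, F i).ncard := Set.ncard_le_ncard hs (ht.biUnion hF)
    _ = (⋃ i ∈ ht.toFinset, F i).ncard := by simp only [Set.Finite.mem_toFinset]
    _ ≤ ∑ i ∈ ht.toFinset, (F i).ncard := Finset.set_ncard_biUnion_le _ _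
    _ ≤ ht.toFinset.card * n := Finset.sum_le_card_nsmul _ _ _ (by simpa using hn)
    _ = t.ncard * n := by rw [Set.ncard_eq_toFinset_card t ht]

/-! ### Components of induced subgraphs -/

lemma joined_symm (h : G.Joined x y) : G.Joined y x :=
  haveI : Std.Symm G.Adj := ⟨fun _ _ h => h.symm⟩
  Relation.ReflTransGen.stdSymm.symm _ _ h

lemma exists_isLink_of_joined (h : G.Joined x y) (hx : x ∈ S) (hy : y ∉ S) :
    ∃ e a b, G.IsLink e a b ∧ a ∈ S ∧ b ∉ S := by
  induction h with
  | refl => exact absurd hx hy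
  | @tail a b _ hab ih =>
    by_cases ha : a ∈ S
    · obtain ⟨e, he⟩ := hab
      exact ⟨e, a, b, he, ha, hy⟩
    · exact ih ha

lemma self_mem_componentIn (G : Graph α β) (S : Set α) (x : α) : x ∈ G.componentIn S x :=
  Relation.ReflTransGen.refl

lemma componentIn_subset (hx : x ∈ S) : G.componentIn S x ⊆ S := by
  intro y hy
  induction hy with
  | refl => exact hx
  | tail _ h _ => exact h.right_mem

lemma mem_componentIn_of_isLink (hx : x ∈ S) (ha : a ∈ G.componentIn S x) (h : G.IsLink e a b)
    (hb : b ∈ S) : b ∈ G.componentIn S x :=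
  Relation.ReflTransGen.tail ha ⟨e, h, componentIn_subset hx ha, hb⟩

lemma componentIn_mono (hHG : H ≤ G) (hST : S ⊆ T) (x : α) :
    H.componentIn S x ⊆ G.componentIn T x := by
  refine fun y hy => Relation.ReflTransGen.mono ?_ _ _ hy
  rintro a b ⟨e, he, ha, hb⟩
  exact ⟨e, he.mono hHG, hST ha, hST hb⟩

lemma componentIn_eq_of_mem (h : y ∈ G.componentIn S x) :
    G.componentIn S y = G.componentIn S x :=
  Set.ext fun _ => ⟨fun hz => Relation.ReflTransGen.trans h hz,
    fun hz => Relation.ReflTransGen.trans (joined_symm h) hz⟩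

lemma componentIn_subset_of_subset (hST : G.componentIn S x ⊆ T) :
    G.componentIn S x ⊆ G.componentIn T x := by
  intro y hy
  induction hy with
  | refl => exact self_mem_componentIn G T x
  | @tail a b h hab ih =>
    obtain ⟨e, he, ha, hb⟩ := hab
    exact Relation.ReflTransGen.tail ih
      ⟨e, he, hST h, hST (Relation.ReflTransGen.tail h ⟨e, he, ha, hb⟩)⟩

lemma edgeBoundary_subset (G : Graph α β) (S : Set α) : G.edgeBoundary S ⊆ E(G) := by
  rintro e ⟨a, b, h, -⟩
  exact h.edge_mem

/-- The vertices outside `S` that have a neighbour in `S`. -/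
def outerNeighbors (G : Graph α β) (S : Set α) : Set α :=
  {b | b ∉ S ∧ ∃ a ∈ S, G.Adj a b}

lemma outerNeighbors_subset (G : Graph α β) (S : Set α) : outerNeighbors G S ⊆ V(G) := by
  rintro b ⟨-, a, -, h⟩
  exact h.right_mem

lemma ncard_outerNeighbors_le (hE : E(G).Finite) (S : Set α) :
    (outerNeighbors G S).ncard ≤ (G.edgeBoundary S).ncard := by
  let outerEnds (e : β) : Set α := {b | b ∉ S ∧ ∃ a ∈ S, G.IsLink e a b}
  have hsub (e : β) : (outerEnds e).Subsingleton := by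
    rintro b ⟨hb, a, -, h⟩ b' ⟨-, a', ha', h'⟩
    obtain rfl | rfl := h.right_eq_or_eq h'
    exacts [absurd ha' hb, rfl]
  rw [← mul_one (G.edgeBoundary S).ncard]
  refine ncard_le_mul_of_subset_biUnion (F := outerEnds) (hE.subset (edgeBoundary_subset G S))
    (fun e _ => (hsub e).finite) ?_
    fun e _ => (Set.ncard_le_one (hsub e).finite).2 fun _ hb _ hb' => hsub e hb hb'
  rintro b ⟨hb, a, ha, e, h⟩
  exact Set.mem_biUnion (x := e) ⟨a, b, h, ha, hb⟩ ⟨hb, a, ha, h⟩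

lemma ncard_edgeBoundary_le_mul (hV : V(G).Finite) (hE : E(G).Finite)
    (hdeg : ∀ v ∈ V(G), G.edgeDegree v ≤ n) (S : Set α) :
    (G.edgeBoundary S).ncard ≤ (outerNeighbors G S).ncard * n := by
  refine ncard_le_mul_of_subset_biUnion (F := fun b => G.edgeBoundary {b})
    (hV.subset (outerNeighbors_subset G S)) (fun b _ => hE.subset (edgeBoundary_subset G {b})) ?_
    fun b hb => hdeg b (outerNeighbors_subset G S hb)
  rintro e ⟨a, b, h, ha, hb⟩
  exact Set.mem_biUnion (x := b) ⟨hb, a, ha, e, h⟩ ⟨b, a, h.symm, rfl, fun hab => hb (hab ▸ ha)⟩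

/-! ### Rankings -/

/-- The vertices of rank at least `n`. -/
def tailFrom (G : Graph α β) (f : α → ℕ) (n : ℕ) : Set α := {y | y ∈ V(G) ∧ n ≤ f y}

/-- The component of `x` among the vertices ranked at least as high as `x`: the set
`C_G(S_i, x_i)` of the layout that lists the vertices by increasing rank. -/
def tailComponent (G : Graph α β) (f : α → ℕ) (x : α) : Set α :=
  G.componentIn (tailFrom G f (f x)) x

/-- `f` ranks the vertices injectively, and every position of the layout that lists them by
increasing rank has edge cost at most `k`. Unlike a layout, a ranking restricts to subgraphs and
need not use consecutive values. -/
structure IsRanking (G : Graph α β) (f : α → ℕ) (k : ℕ) : Prop where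
  injOn : Set.InjOn f V(G)
  cost_le : ∀ x ∈ V(G), (G.edgeBoundary (tailComponent G f x)).ncard ≤ k

lemma tailFrom_mono (hHG : H ≤ G) (hmn : n ≤ m) : tailFrom H f m ⊆ tailFrom G f n :=
  fun _ hy => ⟨hHG.vertexSet_mono hy.1, hmn.trans hy.2⟩

lemma mem_tailComponent_self (G : Graph α β) (f : α → ℕ) (x : α) : x ∈ tailComponent G f x :=
  self_mem_componentIn G _ x

lemma tailComponent_subset (hx : x ∈ V(G)) : tailComponent G f x ⊆ tailFrom G f (f x) :=
  componentIn_subset ⟨hx, le_rfl⟩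

lemma notMem_tailComponent_of_lt (hx : x ∈ V(G)) (h : f y < f x) : y ∉ tailComponent G f x :=
  fun hy => h.not_ge (tailComponent_subset hx hy).2

lemma lt_of_notMem_tailComponent (hx : x ∈ V(G)) (ha : a ∈ tailComponent G f x)
    (h : G.Adj a b) (hb : b ∉ tailComponent G f x) : f b < f x := by
  obtain ⟨e, he⟩ := h
  by_contra! hle
  exact hb (mem_componentIn_of_isLink ⟨hx, le_rfl⟩ ha he ⟨he.right_mem, hle⟩)

lemma IsRanking.ncard_edgeBoundary_componentIn_le (hf : IsRanking G f k) (hV : V(G).Finite)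
    (hy : y ∈ tailFrom G f n) :
    (G.edgeBoundary (G.componentIn (tailFrom G f n) y)).ncard ≤ k := by
  have hsub := componentIn_subset (G := G) hy
  obtain ⟨v, hv, hmin⟩ := Set.exists_min_image _ f (hV.subset fun z hz => (hsub hz).1)
    ⟨y, self_mem_componentIn G (tailFrom G f n) y⟩
  suffices tailComponent G f v = G.componentIn (tailFrom G f n) y from
    this ▸ hf.cost_le v (hsub hv).1
  rw [← componentIn_eq_of_mem hv] at hmin hsub ⊢
  exact (componentIn_mono le_rfl (tailFrom_mono le_rfl (hsub (self_mem_componentIn G _ v)).2)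
    v).antisymm (componentIn_subset_of_subset fun z hz => ⟨(hsub hz).1, hmin z hz⟩)

lemma IsRanking.anti (hf : IsRanking G f k) (hE : E(G).Finite) (hHG : H ≤ G) :
    IsRanking H f k where
  injOn := hf.injOn.mono hHG.vertexSet_mono
  cost_le x hx := by
    refine (Set.ncard_le_ncard ?_ (hE.subset (edgeBoundary_subset G _))).trans
      (hf.cost_le x (hHG.vertexSet_mono hx))
    rintro e ⟨a, b, h, ha, hb⟩
    exact ⟨a, b, h.mono hHG, componentIn_mono hHG (tailFrom_mono hHG le_rfl) x ha,
      notMem_tailComponent_of_lt (hHG.vertexSet_mono hx)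
        (lt_of_notMem_tailComponent hx ha ⟨e, h⟩ hb)⟩

lemma isRanking_of_injOn (hE : E(G).Finite) (hf : Set.InjOn f V(G)) :
    IsRanking G f E(G).ncard :=
  ⟨hf, fun _ _ => Set.ncard_le_ncard (edgeBoundary_subset G _) hE⟩

lemma exists_isRanking_of_layout (L : G.Layout) : ∃ f, IsRanking G f L.maxEdgeCost := by
  classical
  let f : α → ℕ := fun x => if h : x ∈ V(G) then (L.symm ⟨x, h⟩ : ℕ) else 0
  have hfL (i) : f (L i) = i := by simp [f]
  have hL (x) (hx : x ∈ V(G)) : ∃ i, (L i : α) = x := ⟨L.symm ⟨x, hx⟩, by simp⟩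
  refine ⟨f, fun x hx y hy hxy => ?_, fun x hx => ?_⟩
  · obtain ⟨i, rfl⟩ := hL x hx
    obtain ⟨j, rfl⟩ := hL y hy
    rw [hfL, hfL] at hxy
    rw [Fin.ext hxy]
  · obtain ⟨i, rfl⟩ := hL x hx
    have htail : tailFrom G f (f (L i)) = L.tail i := by
      ext y
      constructor
      · rintro ⟨hy, hle⟩
        obtain ⟨j, rfl⟩ := hL y hy
        rw [hfL, hfL] at hle
        exact ⟨j, hle, rfl⟩
      · rintro ⟨j, hij, rfl⟩
        exact ⟨(L j).2, by rwa [hfL, hfL]⟩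
    rw [tailComponent, htail]
    exact Finset.le_sup (f := L.edgeCost) (Finset.mem_univ i)

lemma IsRanking.exists_layout (hf : IsRanking G f k) (hV : V(G).Finite) :
    ∃ L : G.Layout, L.maxEdgeCost ≤ k := by
  have := hV.fintype
  let : LinearOrder V(G) := LinearOrder.lift' (fun x : V(G) => f x) hf.injOn.injective
  let L : Fin V(G).ncard ≃o V(G) := monoEquivOfFin V(G) (Nat.card_eq_fintype_card.symm)
  refine ⟨L.toEquiv, Finset.sup_le fun i _ => ?_⟩
  have htail : Layout.tail (G := G) L.toEquiv i = tailFrom G f (f (L i)) := by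
    ext y
    constructor
    · rintro ⟨j, hij, rfl⟩
      exact ⟨(L j).2, L.monotone hij⟩
    · rintro ⟨hy, hle⟩
      exact ⟨L.symm ⟨y, hy⟩, L.le_symm_apply.2 hle, by simp⟩
  rw [Layout.edgeCost, htail]
  exact hf.cost_le _ (L i).2

lemma IsRanking.edgeTreewidth_le (hf : IsRanking G f k) (hV : V(G).Finite) :
    G.edgeTreewidth ≤ k := by
  obtain ⟨L, hL⟩ := hf.exists_layout hV
  exact (Nat.sInf_le ⟨L, rfl⟩ : G.edgeTreewidth ≤ L.maxEdgeCost).trans hL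

lemma exists_isRanking_edgeTreewidth (hV : V(G).Finite) (hE : E(G).Finite) :
    ∃ f, IsRanking G f G.edgeTreewidth := by
  obtain ⟨f, hf⟩ := Set.countable_iff_exists_injOn.1 hV.countable
  obtain ⟨L₀, -⟩ := (isRanking_of_injOn hE hf).exists_layout hV
  obtain ⟨L, hL⟩ : ∃ L : G.Layout, G.edgeTreewidth = L.maxEdgeCost :=
    Nat.sInf_mem (s := {k | ∃ L : G.Layout, k = L.maxEdgeCost}) ⟨_, L₀, rfl⟩
  exact hL ▸ exists_isRanking_of_layout L

/-! ### Tree decompositions from rankings -/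

lemma preconnected_of_exists_adj_lt {N : Type*} {T : SimpleGraph N} (r : N) (rank : N → ℕ)
    (h : ∀ t ≠ r, ∃ q, T.Adj t q ∧ rank q < rank t) : T.Preconnected := by
  have hreach (t : N) : T.Reachable t r := by
    induction t using (measure rank).wf.induction with
    | _ t ih =>
      obtain rfl | ht := eq_or_ne t r
      · exact SimpleGraph.Reachable.refl _
      · obtain ⟨q, hadj, hlt⟩ := h t ht
        exact hadj.reachable.trans (ih q hlt)
  exact fun s t => (hreach s).trans (hreach t).symm

lemma exists_isTree_of_parent {N : Type*} [Finite N] (r : N) (p : N → N) (rank : N → ℕ)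
    (hp : ∀ t ≠ r, rank (p t) < rank t) :
    ∃ T : SimpleGraph N, T.IsTree ∧ ∀ t ≠ r, T.Adj t (p t) := by
  let T : SimpleGraph N := SimpleGraph.fromRel fun s t => s ≠ r ∧ t = p s
  have hadj (t) (ht : t ≠ r) : T.Adj t (p t) :=
    ⟨fun h => (hp t ht).ne (congrArg rank h.symm), Or.inl ⟨ht, rfl⟩⟩
  have hconn : T.Connected :=
    { preconnected := preconnected_of_exists_adj_lt r rank fun t ht => ⟨p t, hadj t ht, hp t ht⟩
      nonempty := ⟨r⟩ }
  refine ⟨T, SimpleGraph.isTree_iff_connected_and_card.2 ⟨hconn, ?_⟩, hadj⟩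
  refine le_antisymm ?_ hconn.card_vert_le_card_edgeSet_add_one
  have hsub : T.edgeSet ⊆ (fun t => s(t, p t)) '' {r}ᶜ := by
    rintro ⟨s, t⟩ ⟨-, ⟨hs, ht : t = p s⟩ | ⟨ht, hs : s = p t⟩⟩
    exacts [⟨s, hs, ht ▸ rfl⟩, ⟨t, ht, hs ▸ Sym2.eq_swap⟩]
  calc Nat.card T.edgeSet + 1 ≤ ({r}ᶜ : Set N).ncard + 1 :=
        Nat.succ_le_succ ((Set.ncard_le_ncard hsub).trans (Set.ncard_image_le))
    _ = Nat.card N := by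
        rw [add_comm, ← Set.ncard_singleton r, Set.ncard_add_ncard_compl]

lemma tailComponent_subset_of_mem_outerNeighbors (hx : x ∈ V(G))
    (hy : y ∈ outerNeighbors G (tailComponent G f x)) :
    tailComponent G f x ⊆ tailComponent G f y := by
  obtain ⟨hyx, a, ha, e, h⟩ := hy
  have hlt : f y < f x := lt_of_notMem_tailComponent hx ha ⟨e, h⟩ hyx
  have hsub : tailComponent G f x ⊆ tailFrom G f (f y) :=
    (tailComponent_subset hx).trans (tailFrom_mono le_rfl hlt.le)
  have hya : a ∈ tailComponent G f y :=
    mem_componentIn_of_isLink ⟨h.right_mem, le_rfl⟩ (mem_tailComponent_self G f y) h.symm (hsub ha)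
  calc tailComponent G f x ⊆ G.componentIn (tailFrom G f (f y)) x :=
        componentIn_subset_of_subset hsub
    _ = G.componentIn (tailFrom G f (f y)) a :=
        (componentIn_eq_of_mem (componentIn_subset_of_subset hsub ha)).symm
    _ = tailComponent G f y := componentIn_eq_of_mem hya

lemma mem_outerNeighbors_tailComponent_of_lt (hx : x ∈ V(G))
    (ha : a ∈ outerNeighbors G (tailComponent G f x))
    (hb : b ∈ outerNeighbors G (tailComponent G f x)) (hab : f a < f b) :
    a ∈ outerNeighbors G (tailComponent G f b) := by
  obtain ⟨-, c, hc, hca⟩ := ha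
  exact ⟨notMem_tailComponent_of_lt (outerNeighbors_subset G _ hb) hab, c,
    tailComponent_subset_of_mem_outerNeighbors hx hb hc, hca⟩

/-- The bags of the tree decomposition defined by a ranking. The extra node `none`, with an empty
bag, is the root, so that disconnected graphs also give a tree. -/
def rankingBag (G : Graph α β) (f : α → ℕ) : Option V(G) → Set α
  | none => ∅
  | some x => insert x.1 (outerNeighbors G (tailComponent G f x))

/-- `q` is the parent of `x` in the tree defined by a ranking: the outer neighbour of highest rank
of its tail component, or the root `none` if there are no outer neighbours. -/
def IsParent (G : Graph α β) (f : α → ℕ) (x : V(G)) (q : Option V(G)) : Prop :=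
  (∀ y ∈ q, y.1 ∈ outerNeighbors G (tailComponent G f x)) ∧
    ∀ z ∈ outerNeighbors G (tailComponent G f x), ∃ y ∈ q, f z ≤ f y

lemma exists_isParent (hV : V(G).Finite) (f : α → ℕ) (x : V(G)) : ∃ q, IsParent G f x q := by
  obtain hempty | hne := (outerNeighbors G (tailComponent G f x)).eq_empty_or_nonempty
  · exact ⟨none, nofun, by simp [hempty]⟩
  obtain ⟨y, hy, hmax⟩ := Set.exists_max_image _ f (hV.subset (outerNeighbors_subset G _)) hne
  refine ⟨some ⟨y, outerNeighbors_subset G _ hy⟩, ?_, fun z hz => ⟨_, rfl, hmax z hz⟩⟩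
  rintro _ ⟨⟩
  exact hy

lemma IsParent.lt {x y : V(G)} (h : IsParent G f x (some y)) : f y < f x := by
  obtain ⟨hyx, a, ha, hay⟩ := h.1 y rfl
  exact lt_of_notMem_tailComponent x.2 ha hay hyx

lemma preconnected_induce_rankingBag (hf : Set.InjOn f V(G)) {T : SimpleGraph (Option V(G))}
    (hT : ∀ t, ∃ q, IsParent G f t q ∧ T.Adj (some t) q) (hx : x ∈ V(G)) :
    (T.induce {t | x ∈ rankingBag G f t}).Preconnected := by
  refine preconnected_of_exists_adj_lt ⟨some ⟨x, hx⟩, Set.mem_insert _ _⟩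
    (fun t => t.1.elim 0 fun y => f y) ?_
  rintro ⟨_ | t, ht⟩ hne
  · exact ht.elim
  obtain rfl | hxt := ht
  · exact absurd rfl hne
  obtain ⟨_ | y, hy, hadj⟩ := hT t
  · obtain ⟨_, ⟨⟩, -⟩ := hy.2 x hxt
  obtain ⟨_, ⟨⟩, hle⟩ := hy.2 x hxt
  have hxy : x ∈ rankingBag G f (some y) := by
    obtain heq | hlt := hle.eq_or_lt
    · exact Or.inl (hf hx y.2 heq)
    · exact Or.inr (mem_outerNeighbors_tailComponent_of_lt t.2 hxt (hy.1 y rfl) hlt)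
  exact ⟨⟨some y, hxy⟩, hadj, hy.lt⟩

lemma exists_mem_rankingBag_of_isLink (hf : Set.InjOn f V(G)) (h : G.IsLink e a b) :
    ∃ t, a ∈ rankingBag G f t ∧ b ∈ rankingBag G f t := by
  wlog hab : f a ≤ f b generalizing a b
  · obtain ⟨t, hb, ha⟩ := this h.symm (le_of_not_ge hab)
    exact ⟨t, ha, hb⟩
  refine ⟨some ⟨b, h.right_mem⟩, ?_, Set.mem_insert _ _⟩
  obtain heq | hlt := hab.eq_or_lt
  · exact Or.inl (hf h.left_mem h.right_mem heq)
  · exact Or.inr ⟨notMem_tailComponent_of_lt h.right_mem hlt, b, mem_tailComponent_self G f b,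
      e, h.symm⟩

lemma IsRanking.exists_treeDecomposition (hf : IsRanking G f k) (hV : V(G).Finite)
    (hE : E(G).Finite) : ∃ D : G.TreeDecomposition, ∀ t, (D.bag t).ncard ≤ k + 1 := by
  have : Finite V(G) := hV
  choose p hp using exists_isParent hV f
  obtain ⟨T, hT, hadj⟩ := exists_isTree_of_parent none (fun t : Option V(G) => t.bind p)
    (fun t => t.elim 0 fun x => f x + 1) <| by
      rintro (_ | t) ht
      · exact absurd rfl ht
      · obtain hnone | ⟨q, hq⟩ := (p t).eq_none_or_eq_some
        · simp [hnone]
        · simpa [hq] using (hq ▸ hp t : IsParent G f t (some q)).lt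
  refine ⟨⟨Option V(G), inferInstance, T, hT, rankingBag G f, ?_,
    fun x hx => ⟨some ⟨x, hx⟩, Set.mem_insert _ _⟩,
    fun _ _ _ => exists_mem_rankingBag_of_isLink hf.injOn,
    fun x hx => preconnected_induce_rankingBag hf.injOn
      (fun t => ⟨p t, hp t, hadj (some t) nofun⟩) hx⟩, ?_⟩
  · rintro (_ | t)
    · exact Set.empty_subset _
    · exact Set.insert_subset t.2 (outerNeighbors_subset G _)
  · rintro (_ | t)
    · simp [rankingBag]
    · exact (Set.ncard_insert_le _ _).trans <| Nat.succ_le_succ <|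
        (ncard_outerNeighbors_le hE _).trans (hf.cost_le t t.2)

lemma IsRanking.treewidth_le (hf : IsRanking G f k) (hV : V(G).Finite) (hE : E(G).Finite) :
    G.treewidth ≤ k :=
  Nat.sInf_le (hf.exists_treeDecomposition hV hE)

lemma exists_treeDecomposition_treewidth (hV : V(G).Finite) (hE : E(G).Finite) :
    ∃ D : G.TreeDecomposition, ∀ t, (D.bag t).ncard ≤ G.treewidth + 1 := by
  obtain ⟨f, hf⟩ := exists_isRanking_edgeTreewidth hV hE
  exact Nat.sInf_mem (s := {k | ∃ D : G.TreeDecomposition, ∀ t, (D.bag t).ncard ≤ k + 1})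
    ⟨_, hf.exists_treeDecomposition hV hE⟩

/-! ### Edge-degrees from rankings -/

lemma IsRanking.edgeDegree_le_of_forall_le (hf : IsRanking G f k) (hV : V(G).Finite)
    (hE : E(G).Finite) (hx : x ∈ V(G)) (hcut : (G.deleteVerts {x}).IsPreconnected)
    (hy : y ∈ tailFrom G f (f x + 1))
    (habove : ∀ a ∈ G.componentIn (tailFrom G f (f x + 1)) y, ∀ b, G.Adj a b → f x ≤ f b) :
    G.edgeDegree x ≤ k := by
  set K := G.componentIn (tailFrom G f (f x + 1)) y
  have hxK : x ∉ K := fun h => Nat.not_succ_le_self _ (componentIn_subset hy h).2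
  have hK (z) (hz : z ∈ V(G)) (hzx : z ≠ x) : z ∈ K := by
    by_contra hzK
    have hyx : y ≠ x := fun h => hxK (h ▸ self_mem_componentIn G _ y)
    obtain ⟨e, a, b, hab, ha, hb⟩ := exists_isLink_of_joined
      (hcut y ⟨hy.1, hyx⟩ z ⟨hz, hzx⟩) (self_mem_componentIn G _ y) hzK
    obtain ⟨hab, -, hbx⟩ := (deleteVerts_isLink G {x}).1 hab
    have hlt : f x < f b := (habove a ha b ⟨e, hab⟩).lt_of_ne
      fun h => hbx (hf.injOn hab.right_mem hx h.symm)
    exact hb (mem_componentIn_of_isLink hy ha hab ⟨hab.right_mem, hlt⟩)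
  have hsub : G.edgeBoundary {x} ⊆ G.edgeBoundary K := by
    rintro e ⟨_, b, h, rfl, hb⟩
    exact ⟨b, _, h.symm, hK b h.right_mem hb, hxK⟩
  exact (Set.ncard_le_ncard hsub (hE.subset (edgeBoundary_subset G K))).trans
    (hf.ncard_edgeBoundary_componentIn_le hV hy)

/-- The edges at `x` charged to an edge `e` of the boundary of the tail component of `x`: `e`
itself and, if `e` leads from a component of the vertices ranked above `x` to a vertex ranked below
`x`, the boundary of that component. -/
def chargedTo (G : Graph α β) (f : α → ℕ) (x : α) (e : β) : Set β :=
  insert e {d | ∃ a b, G.IsLink e a b ∧ a ∈ tailFrom G f (f x + 1) ∧ f b < f x ∧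
    d ∈ G.edgeBoundary (G.componentIn (tailFrom G f (f x + 1)) a)}

lemma finite_chargedTo (hE : E(G).Finite) (x : α) (e : β) : (chargedTo G f x e).Finite := by
  refine (hE.subset ?_).insert e
  rintro d ⟨a, b, -, -, -, hd⟩
  exact edgeBoundary_subset G _ hd

lemma IsRanking.ncard_chargedTo_le (hf : IsRanking G f k) (hV : V(G).Finite) (hE : E(G).Finite)
    (hx : x ∈ V(G)) (he : e ∈ G.edgeBoundary (tailComponent G f x)) :
    (chargedTo G f x e).ncard ≤ k := by
  by_cases hex : ∃ a b, G.IsLink e a b ∧ a ∈ tailFrom G f (f x + 1) ∧ f b < f x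
  · obtain ⟨a, b, h, ha, hb⟩ := hex
    refine (Set.ncard_le_ncard ?_ (hE.subset (edgeBoundary_subset G _))).trans
      (hf.ncard_edgeBoundary_componentIn_le hV ha)
    rintro d (rfl | ⟨a', b', h', ha', hb', hd⟩)
    · refine ⟨a, b, h, self_mem_componentIn G _ a, fun hb' => ?_⟩
      have := (componentIn_subset ha hb').2
      omega
    · obtain rfl | rfl := h.left_eq_or_eq h'
      · exact hd
      · have := ha.2
        omega
  · have hsub : chargedTo G f x e ⊆ {e} := by
      rintro d (rfl | ⟨a, b, h, ha, hb, -⟩)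
      exacts [rfl, absurd ⟨a, b, h, ha, hb⟩ hex]
    calc (chargedTo G f x e).ncard ≤ 1 :=
          (Set.ncard_le_ncard hsub).trans (Set.ncard_singleton e).le
      _ ≤ (G.edgeBoundary (tailComponent G f x)).ncard :=
          (Set.ncard_pos (hE.subset (edgeBoundary_subset G _))).2 ⟨e, he⟩
      _ ≤ k := hf.cost_le x hx

lemma exists_mem_chargedTo (hf : Set.InjOn f V(G)) (hx : x ∈ V(G))
    (hbelow : ∀ y ∈ tailFrom G f (f x + 1),
      ∃ a ∈ G.componentIn (tailFrom G f (f x + 1)) y, ∃ b, G.Adj a b ∧ f b < f x)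
    (he : e ∈ G.edgeBoundary {x}) :
    ∃ d ∈ G.edgeBoundary (tailComponent G f x), e ∈ chargedTo G f x d := by
  obtain ⟨x', y, hxy, hx', hy⟩ := he
  obtain rfl : x = x' := hx'.symm
  obtain hlt | heq | hlt := lt_trichotomy (f y) (f x)
  · exact ⟨e, ⟨x, y, hxy, mem_tailComponent_self G f x, notMem_tailComponent_of_lt hx hlt⟩,
      Set.mem_insert _ _⟩
  · exact absurd (hf hxy.right_mem hx heq) hy
  have hyS : y ∈ tailFrom G f (f x + 1) := ⟨hxy.right_mem, hlt⟩
  have hsub : tailFrom G f (f x + 1) ⊆ tailFrom G f (f x) := tailFrom_mono le_rfl (Nat.le_succ _)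
  obtain ⟨a, ha, b, ⟨d, hab⟩, hb⟩ := hbelow y hyS
  have haS := componentIn_subset hyS ha
  have hax : a ∈ tailComponent G f x := by
    have hyx : y ∈ tailComponent G f x :=
      mem_componentIn_of_isLink ⟨hx, le_rfl⟩ (mem_tailComponent_self G f x) hxy (hsub hyS)
    rw [tailComponent, ← componentIn_eq_of_mem hyx]
    exact componentIn_mono le_rfl hsub y ha
  refine ⟨d, ⟨a, b, hab, hax, notMem_tailComponent_of_lt hx hb⟩,
    Or.inr ⟨a, b, hab, haS, hb, y, x, hxy.symm, ?_, fun hx' => ?_⟩⟩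
  · rw [componentIn_eq_of_mem ha]
    exact self_mem_componentIn G _ y
  · exact Nat.not_succ_le_self _ (componentIn_subset haS hx').2

lemma IsRanking.edgeDegree_le (hf : IsRanking G f k) (hV : V(G).Finite) (hE : E(G).Finite)
    (hx : x ∈ V(G)) (hcut : (G.deleteVerts {x}).IsPreconnected) : G.edgeDegree x ≤ k ^ 2 := by
  by_cases hbelow : ∀ y ∈ tailFrom G f (f x + 1),
      ∃ a ∈ G.componentIn (tailFrom G f (f x + 1)) y, ∃ b, G.Adj a b ∧ f b < f x
  · have hsub : G.edgeBoundary {x} ⊆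
        ⋃ e ∈ G.edgeBoundary (tailComponent G f x), chargedTo G f x e := fun e he => by
      simpa only [Set.mem_iUnion₂, exists_prop] using exists_mem_chargedTo hf.injOn hx hbelow he
    calc G.edgeDegree x ≤ (G.edgeBoundary (tailComponent G f x)).ncard * k :=
          ncard_le_mul_of_subset_biUnion (hE.subset (edgeBoundary_subset G _))
            (fun e _ => finite_chargedTo hE x e) hsub
            fun e he => hf.ncard_chargedTo_le hV hE hx he
      _ ≤ k * k := Nat.mul_le_mul_right k (hf.cost_le x hx)
      _ = k ^ 2 := (sq k).symm
  · push Not at hbelow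
    obtain ⟨y, hy, habove⟩ := hbelow
    exact (hf.edgeDegree_le_of_forall_le hV hE hx hcut hy habove).trans
      (Nat.le_self_pow two_ne_zero k)

/-! ### Rankings from tree decompositions -/

section RootedTree

variable {N : Type*} {T : SimpleGraph N} {r s s' t : N}

/-- In the tree `T` rooted at `r`, the node `s` lies in the subtree below `t`. -/
def IsBelow (T : SimpleGraph N) (r t s : N) : Prop := ∀ p : T.Walk r s, t ∈ p.support

lemma isBelow_self (T : SimpleGraph N) (r t : N) : IsBelow T r t t := fun p => p.end_mem_support

lemma IsBelow.eq_of_adj (hs : IsBelow T r t s) (h : T.Adj s s') (hs' : ¬ IsBelow T r t s') :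
    s = t := by
  obtain ⟨p, hp⟩ := not_forall.1 hs'
  have hmem := hs (p.concat h.symm)
  rw [SimpleGraph.Walk.support_concat, List.mem_append,
    List.mem_singleton] at hmem
  exact (hmem.resolve_left hp).symm

lemma dist_lt_of_adj_of_not_isBelow (hT : T.IsTree) (h : T.Adj t s) (hs : ¬ IsBelow T r t s) :
    T.dist r s < T.dist r t := by
  classical
  obtain ⟨p, hp⟩ := not_forall.1 hs
  have hpath : (p.bypass.concat h.symm).IsPath :=
    p.bypass_isPath.concat (fun ht => hp (p.support_bypass_subset_support ht)) h.symm
  obtain ⟨q, hq, hlen⟩ := hT.connected.exists_path_of_dist r t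
  calc T.dist r s ≤ p.bypass.length := SimpleGraph.dist_le _
    _ < (p.bypass.concat h.symm).length := by simp
    _ = q.length := congrArg _ ((hT.existsUnique_path r t).unique hpath hq)
    _ = T.dist r t := hlen

lemma IsBelow.eq_of_dist_le (hT : T.Connected) (hs : IsBelow T r t s)
    (h : T.dist r s ≤ T.dist r t) : s = t := by
  classical
  obtain ⟨p, hp⟩ := hT.exists_walk_length_eq_dist r s
  by_contra hne
  have hlt := SimpleGraph.Walk.length_takeUntil_lt_length (hs p) (Ne.symm hne)
  have hle := SimpleGraph.dist_le (p.takeUntil t (hs p))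
  omega

end RootedTree

section Depth

variable {D : G.TreeDecomposition} {t₀ s s' t : D.Node}

/-- The least distance to the root `t₀` of a node whose bag contains `x`. -/
noncomputable def depth (D : G.TreeDecomposition) (t₀ : D.Node) (x : α) : ℕ :=
  sInf (D.tree.dist t₀ '' {t | x ∈ D.bag t})

lemma depth_le (t₀ : D.Node) (ht : x ∈ D.bag t) : depth D t₀ x ≤ D.tree.dist t₀ t :=
  Nat.sInf_le ⟨t, ht, rfl⟩

lemma exists_mem_bag_dist_eq_depth (D : G.TreeDecomposition) (t₀ : D.Node) (hx : x ∈ V(G)) :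
    ∃ t, x ∈ D.bag t ∧ D.tree.dist t₀ t = depth D t₀ x := by
  obtain ⟨s, hs⟩ := D.exists_mem_bag x hx
  exact Nat.sInf_mem (s := D.tree.dist t₀ '' {t | x ∈ D.bag t}) ⟨_, s, hs, rfl⟩

lemma mem_bag_and_depth_lt (hs : x ∈ D.bag s) (hst : IsBelow D.tree t₀ t s)
    (hs' : x ∈ D.bag s') (hst' : ¬ IsBelow D.tree t₀ t s') :
    x ∈ D.bag t ∧ depth D t₀ x < D.tree.dist t₀ t := by
  obtain ⟨p⟩ := D.bag_connected x (D.bag_subset s hs) ⟨s, hs⟩ ⟨s', hs'⟩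
  obtain ⟨⟨⟨u, u'⟩, hadj⟩, -, hu, hout⟩ :=
    p.exists_boundary_dart {u | IsBelow D.tree t₀ t u.1} hst hst'
  have hadj : D.tree.Adj u.1 u'.1 := hadj
  obtain rfl := IsBelow.eq_of_adj hu hadj hout
  exact ⟨u.2, (depth_le t₀ u'.2).trans_lt (dist_lt_of_adj_of_not_isBelow D.isTree hadj hout)⟩

/-- `f` orders the vertices by their depth in the tree decomposition `D` rooted at `t₀`. -/
def RefinesDepth (D : G.TreeDecomposition) (t₀ : D.Node) (f : α → ℕ) : Prop :=
  ∀ ⦃x⦄, x ∈ V(G) → ∀ ⦃y⦄, y ∈ V(G) → f x ≤ f y → depth D t₀ x ≤ depth D t₀ y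

lemma RefinesDepth.isBelow_of_mem_tailComponent (hf : RefinesDepth D t₀ f) (hxt : x ∈ D.bag t)
    (ht : D.tree.dist t₀ t = depth D t₀ x) (hy : y ∈ tailComponent G f x) (hys : y ∈ D.bag s) :
    IsBelow D.tree t₀ t s := by
  have hx := D.bag_subset t hxt
  have hbelow {z} (hz : z ∈ tailFrom G f (f x)) {s} (hs : z ∈ D.bag s)
      (hst : IsBelow D.tree t₀ t s) {s'} (hs' : z ∈ D.bag s') : IsBelow D.tree t₀ t s' := by
    by_contra hst'
    have hlt := (mem_bag_and_depth_lt hs hst hs' hst').2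
    rw [ht] at hlt
    exact hlt.not_ge (hf hx hz.1 hz.2)
  induction hy generalizing s with
  | refl => exact hbelow ⟨hx, le_rfl⟩ hxt (isBelow_self _ _ _) hys
  | @tail a b _ hab ih =>
    obtain ⟨e, hab, -, hb⟩ := hab
    obtain ⟨u, hau, hbu⟩ := D.exists_link_bag e a b hab
    exact hbelow hb hbu (ih hau) hys

lemma RefinesDepth.outerNeighbors_subset (hf : RefinesDepth D t₀ f) (hxt : x ∈ D.bag t)
    (ht : D.tree.dist t₀ t = depth D t₀ x) :
    outerNeighbors G (tailComponent G f x) ⊆ D.bag t \ {x} := by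
  rintro b ⟨hb, a, ha, e, hab⟩
  have hx := D.bag_subset t hxt
  refine ⟨?_, fun hbx => hb (hbx ▸ mem_tailComponent_self G f x)⟩
  obtain ⟨s, has, hbs⟩ := D.exists_link_bag e a b hab
  have hst := hf.isBelow_of_mem_tailComponent hxt ht ha has
  obtain ⟨u, hbu, hu⟩ := exists_mem_bag_dist_eq_depth D t₀ hab.right_mem
  by_cases hut : IsBelow D.tree t₀ t u
  · have hle : D.tree.dist t₀ u ≤ D.tree.dist t₀ t :=
      hu ▸ ht ▸ hf hab.right_mem hx (lt_of_notMem_tailComponent hx ha ⟨e, hab⟩ hb).le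
    exact hut.eq_of_dist_le D.isTree.connected hle ▸ hbu
  · exact (mem_bag_and_depth_lt hbs hst hbu hut).1

lemma RefinesDepth.isRanking (hf : RefinesDepth D t₀ f) (hinj : Set.InjOn f V(G))
    (hV : V(G).Finite) (hE : E(G).Finite) (hD : ∀ t, (D.bag t).ncard ≤ n + 1)
    (hdeg : ∀ v ∈ V(G), G.edgeDegree v ≤ m) : IsRanking G f (n * m) := by
  refine ⟨hinj, fun x hx => ?_⟩
  obtain ⟨t, hxt, ht⟩ := exists_mem_bag_dist_eq_depth D t₀ hx
  have hfin : (D.bag t).Finite := hV.subset (D.bag_subset t)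
  refine (ncard_edgeBoundary_le_mul hV hE hdeg _).trans (Nat.mul_le_mul_right m ?_)
  calc (outerNeighbors G (tailComponent G f x)).ncard ≤ (D.bag t \ {x}).ncard :=
        Set.ncard_le_ncard (hf.outerNeighbors_subset hxt ht) hfin.sdiff
    _ ≤ n := by
        have := Set.ncard_sdiff_singleton_add_one hxt hfin
        have := hD t
        omega

end Depth

lemma exists_injOn_refining {ε : Type*} {s : Set ε} (hs : s.Finite) {g : ε → ℕ} {r : ε}
    (hr : g r = 0) : ∃ f : ε → ℕ, Set.InjOn f s ∧ f r = 0 ∧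
      ∀ x ∈ s, ∀ y ∈ s, f x ≤ f y → g x ≤ g y := by
  classical
  obtain ⟨h₀, hh₀⟩ := Set.countable_iff_exists_injOn.1 hs.countable
  let h (x : ε) : ℕ := if x = r then 0 else h₀ x + 1
  have hh : Set.InjOn h s := fun x hx y hy hxy => by
    by_cases hxr : x = r <;> by_cases hyr : y = r
    · rw [hxr, hyr]
    · simp [h, hxr, hyr] at hxy
    · simp [h, hxr, hyr] at hxy
    · simp only [h, if_neg hxr, if_neg hyr, Nat.add_right_cancel_iff] at hxy
      exact hh₀ hx hy hxy
  obtain ⟨M, hM⟩ := (hs.image h).bddAbove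
  have hlt (x) (hx : x ∈ s) : h x < M + 1 := Nat.lt_succ_of_le (hM ⟨x, hx, rfl⟩)
  have hdiv (x) (hx : x ∈ s) : (h x + (M + 1) * g x) / (M + 1) = g x := by
    rw [Nat.add_mul_div_left _ _ M.succ_pos, Nat.div_eq_of_lt (hlt x hx), zero_add]
  have hmod (x) (hx : x ∈ s) : (h x + (M + 1) * g x) % (M + 1) = h x := by
    rw [Nat.add_mul_mod_self_left, Nat.mod_eq_of_lt (hlt x hx)]
  refine ⟨fun x => h x + (M + 1) * g x, fun x hx y hy hxy => hh hx hy ?_, by simp [h, hr],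
    fun x hx y hy hxy => ?_⟩
  · rw [← hmod x hx, ← hmod y hy]
    exact congrArg (· % (M + 1)) hxy
  · rw [← hdiv x hx, ← hdiv y hy]
    exact Nat.div_le_div_right hxy

lemma exists_isRanking_of_treeDecomposition (hV : V(G).Finite) (hE : E(G).Finite)
    (D : G.TreeDecomposition) (hD : ∀ t, (D.bag t).ncard ≤ n + 1)
    (hdeg : ∀ v ∈ V(G), G.edgeDegree v ≤ m) {r : α} (hr : r ∈ V(G)) :
    ∃ f, IsRanking G f (n * m) ∧ f r = 0 := by
  obtain ⟨t₀, ht₀⟩ := D.exists_mem_bag r hr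
  have hdepth : depth D t₀ r = 0 := by
    simpa only [SimpleGraph.dist_self, Nat.le_zero] using depth_le t₀ ht₀
  obtain ⟨f, hinj, hfr, hf⟩ := exists_injOn_refining hV hdepth
  have hf : RefinesDepth D t₀ f := hf
  exact ⟨f, hf.isRanking hinj hV hE hD hdeg, hfr⟩

/-! ### Separations of order at most one -/

variable {A B X K : Set α} {c r : α} {f₁ f₂ : α → ℕ}

/-- `A` and `B` are proper subsets that cover `G` and share at most one vertex: a separation of
order at most one. -/
structure IsSeparation (G : Graph α β) (A B : Set α) : Prop where
  left_ssubset : A ⊂ V(G)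
  right_ssubset : B ⊂ V(G)
  union_eq : A ∪ B = V(G)
  inter_subsingleton : (A ∩ B).Subsingleton
  mem_or_mem : ∀ ⦃a b⦄, G.Adj a b → (a ∈ A ∧ b ∈ A) ∨ (a ∈ B ∧ b ∈ B)

lemma IsSeparation.symm (h : IsSeparation G A B) : IsSeparation G B A where
  left_ssubset := h.right_ssubset
  right_ssubset := h.left_ssubset
  union_eq := Set.union_comm B A ▸ h.union_eq
  inter_subsingleton := Set.inter_comm B A ▸ h.inter_subsingleton
  mem_or_mem _ _ hab := (h.mem_or_mem hab).symm

lemma IsSeparation.exists_mem_inter_subset (h : IsSeparation G A B) : ∃ c ∈ B, A ∩ B ⊆ {c} := by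
  obtain hempty | ⟨c, hc⟩ := (A ∩ B).eq_empty_or_nonempty
  · obtain ⟨c, hc, hcA⟩ := Set.exists_of_ssubset h.left_ssubset
    have hcB : c ∈ B := (h.union_eq.symm ▸ hc : c ∈ A ∪ B).resolve_left hcA
    exact ⟨c, hcB, hempty ▸ Set.empty_subset _⟩
  · exact ⟨c, hc.2, fun a ha => h.inter_subsingleton ha hc⟩

lemma isSeparation_of_closed (hKV : K ⊆ V(G)) (hXV : X ⊆ V(G)) (hX : X.Subsingleton)
    (hK : ∀ ⦃a b⦄, G.Adj a b → a ∈ K → b ∈ K ∪ X) (hx : x ∈ K) (hy : y ∈ V(G) \ (K ∪ X)) :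
    IsSeparation G (K ∪ X) (V(G) \ K) where
  left_ssubset := (Set.ssubset_iff_of_subset (Set.union_subset hKV hXV)).2 ⟨y, hy⟩
  right_ssubset := (Set.ssubset_iff_of_subset Set.sdiff_subset).2 ⟨x, hKV hx, fun h => h.2 hx⟩
  union_eq := by
    rw [Set.union_right_comm, Set.union_sdiff_cancel hKV, Set.union_eq_left.2 hXV]
  inter_subsingleton := hX.anti fun _ ha => ha.1.resolve_left ha.2.2
  mem_or_mem a b hab := by
    by_cases ha : a ∈ K
    · exact Or.inl ⟨Or.inl ha, hK hab ha⟩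
    by_cases hb : b ∈ K
    · exact Or.inl ⟨hK hab.symm hb, Or.inl hb⟩
    · exact Or.inr ⟨⟨hab.left_mem, ha⟩, hab.right_mem, hb⟩

lemma exists_isSeparation_of_not_isPreconnected (hXV : X ⊆ V(G)) (hX : X.Subsingleton)
    (h : ¬ (G.deleteVerts X).IsPreconnected) : ∃ A B, IsSeparation G A B := by
  simp only [Graph.IsPreconnected, not_forall, exists_prop] at h
  obtain ⟨x, hx, y, hy, hxy⟩ := h
  have hK : {z | (G.deleteVerts X).Joined x z} ⊆ V(G) \ X := by
    intro z hz
    obtain rfl | ⟨w, -, hwz⟩ := Relation.ReflTransGen.cases_tail hz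
    exacts [hx, hwz.right_mem]
  refine ⟨_, _, isSeparation_of_closed (hK.trans Set.sdiff_subset) hXV hX ?_
    Relation.ReflTransGen.refl ⟨hy.1, not_or.2 ⟨hxy, hy.2⟩⟩⟩
  rintro a b ⟨e, hab⟩ ha
  by_cases hb : b ∈ X
  · exact Or.inr hb
  · exact Or.inl (Relation.ReflTransGen.tail ha
      ⟨e, (deleteVerts_isLink G X).2 ⟨hab, (hK ha).2, hb⟩⟩)

@[elab_as_elim]
theorem separation_induction {P : (G : Graph α β) → V(G).Finite → Prop}
    (base : ∀ (G : Graph α β) (hV : V(G).Finite), G.IsPreconnected →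
      (∀ x ∈ V(G), (G.deleteVerts {x}).IsPreconnected) → P G hV)
    (glue : ∀ (G : Graph α β) (hV : V(G).Finite) (A B : Set α) (h : IsSeparation G A B),
      P (G.induce A) (hV.subset h.left_ssubset.subset) →
      P (G.induce B) (hV.subset h.right_ssubset.subset) → P G hV)
    (G : Graph α β) (hV : V(G).Finite) : P G hV := by
  induction hn : V(G).ncard using Nat.strong_induction_on generalizing G with
  | _ n ih =>
    by_cases hsep : ∃ A B, IsSeparation G A B
    · obtain ⟨A, B, h⟩ := hsep
      have ih_side {X : Set α} (hX : X ⊂ V(G)) : P (G.induce X) (hV.subset hX.subset) :=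
        ih _ (hn ▸ Set.ncard_lt_ncard hX hV) _ _ rfl
      exact glue G hV A B h (ih_side h.left_ssubset) (ih_side h.right_ssubset)
    · have hpre (X) (hXV : X ⊆ V(G)) (hX : X.Subsingleton) : (G.deleteVerts X).IsPreconnected :=
        not_not.1 fun h => hsep (exists_isSeparation_of_not_isPreconnected hXV hX h)
      refine base G hV ?_ fun x hx =>
        hpre {x} (Set.singleton_subset_iff.2 hx) Set.subsingleton_singleton
      have := hpre ∅ (Set.empty_subset _) Set.subsingleton_empty
      rwa [deleteVerts_empty] at this

open Classical in
lemma reflTransGen_retract {R : α → α → Prop} (hAB : A ∩ B ⊆ {c})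
    (hR : ∀ ⦃a b⦄, R a b → (a ∈ A ∧ b ∈ A) ∨ (a ∈ B ∧ b ∈ B)) (h : Relation.ReflTransGen R x y) :
    Relation.ReflTransGen (fun a b => R a b ∧ a ∈ A ∧ b ∈ A)
      (if x ∈ A then x else c) (if y ∈ A then y else c) := by
  have hB (a) (ha : a ∈ B) : (if a ∈ A then a else c) = c :=
    ite_eq_right_iff.2 fun haA => hAB ⟨haA, ha⟩
  refine Relation.ReflTransGen.lift' (fun a => if a ∈ A then a else c) (fun a b hab => ?_) _ _ h
  simp only [Function.onFun]
  obtain ⟨ha, hb⟩ | ⟨ha, hb⟩ := hR hab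
  · rw [if_pos ha, if_pos hb]
    exact Relation.ReflTransGen.single ⟨hab, ha, hb⟩
  · rw [hB a ha, hB b hb]

lemma IsSeparation.joined_deleteEdges_induce (h : IsSeparation G A B) (hx : x ∈ A) (hy : y ∈ A)
    (hxy : (G.deleteEdges {e}).Joined x y) : ((G.induce A).deleteEdges {e}).Joined x y := by
  obtain ⟨c, -, hc⟩ := h.exists_mem_inter_subset
  have hret := reflTransGen_retract hc
    (fun a b hab => h.mem_or_mem (hab.mono deleteEdges_le)) hxy
  rw [if_pos hx, if_pos hy] at hret
  refine Relation.ReflTransGen.mono ?_ _ _ hret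
  rintro a b ⟨⟨d, hab⟩, ha, hb⟩
  exact ⟨d, ⟨hab.1, ha, hb⟩, hab.2⟩

open Classical in
/-- Ranks the vertices of `A` by `f₁`, and then the other vertices by `f₂`. The offset `M` is meant
to exceed all values of `f₁` on `A`. -/
noncomputable def glueRanking (A : Set α) (M : ℕ) (f₁ f₂ : α → ℕ) (y : α) : ℕ :=
  if y ∈ A then f₁ y else M + f₂ y

lemma glueRanking_of_mem (hy : y ∈ A) (M : ℕ) (f₁ f₂ : α → ℕ) :
    glueRanking A M f₁ f₂ y = f₁ y := if_pos hy

lemma glueRanking_of_notMem (hy : y ∉ A) (M : ℕ) (f₁ f₂ : α → ℕ) :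
    glueRanking A M f₁ f₂ y = M + f₂ y := if_neg hy

lemma mem_of_glueRanking_lt (h : glueRanking A m f₁ f₂ y < m) : y ∈ A := by
  by_contra hy
  rw [glueRanking_of_notMem hy] at h
  omega

lemma injOn_glueRanking (hM : ∀ a ∈ A, f₁ a < m) (h₁ : Set.InjOn f₁ A) (h₂ : Set.InjOn f₂ B) :
    Set.InjOn (glueRanking A m f₁ f₂) (A ∪ B) := by
  have hlt {y z} (hy : y ∈ A) (hz : z ∉ A) :
      glueRanking A m f₁ f₂ y < glueRanking A m f₁ f₂ z := by
    rw [glueRanking_of_mem hy, glueRanking_of_notMem hz]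
    exact Nat.lt_add_right _ (hM y hy)
  intro y hy z hz hyz
  by_cases hyA : y ∈ A <;> by_cases hzA : z ∈ A
  · rw [glueRanking_of_mem hyA, glueRanking_of_mem hzA] at hyz
    exact h₁ hyA hzA hyz
  · exact absurd hyz (hlt hyA hzA).ne
  · exact absurd hyz (hlt hzA hyA).ne'
  · rw [glueRanking_of_notMem hyA, glueRanking_of_notMem hzA] at hyz
    exact h₂ (hy.resolve_left hyA) (hz.resolve_left hzA) (Nat.add_left_cancel hyz)

lemma IsSeparation.edgeBoundary_tailComponent_subset_left (h : IsSeparation G A B)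
    (hM : ∀ a ∈ A, f₁ a < m) (hx : x ∈ A) :
    G.edgeBoundary (tailComponent G (glueRanking A m f₁ f₂) x) ⊆
      (G.induce A).edgeBoundary (tailComponent (G.induce A) f₁ x) := by
  classical
  obtain ⟨c, -, hc⟩ := h.exists_mem_inter_subset
  have hret {a} (ha : a ∈ tailComponent G (glueRanking A m f₁ f₂) x) :
      (if a ∈ A then a else c) ∈ tailComponent (G.induce A) f₁ x := by
    have hret := reflTransGen_retract hc
      (fun a b ⟨d, hab⟩ => h.mem_or_mem ⟨d, hab.1⟩) ha
    rw [if_pos hx] at hret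
    refine Relation.ReflTransGen.mono ?_ _ _ hret
    rintro a b ⟨⟨d, hab, ha, hb⟩, haA, hbA⟩
    have hfa := ha.2
    have hfb := hb.2
    rw [glueRanking_of_mem hx, glueRanking_of_mem haA] at hfa
    rw [glueRanking_of_mem hx, glueRanking_of_mem hbA] at hfb
    exact ⟨d, ⟨hab, haA, hbA⟩, ⟨haA, hfa⟩, hbA, hfb⟩
  rintro d ⟨a, b, hab, ha, hb⟩
  have hlt := lt_of_notMem_tailComponent (h.left_ssubset.subset hx) ha ⟨d, hab⟩ hb
  rw [glueRanking_of_mem hx] at hlt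
  have hbA : b ∈ A := mem_of_glueRanking_lt (hlt.trans (hM x hx))
  rw [glueRanking_of_mem hbA] at hlt
  have hb' : b ∉ tailComponent (G.induce A) f₁ x := notMem_tailComponent_of_lt hx hlt
  have haA : a ∈ A := by
    by_contra haA
    have hbB := ((h.mem_or_mem ⟨d, hab⟩).resolve_left fun h => haA h.1).2
    have hcx := hret ha
    rw [if_neg haA, ← hc ⟨hbA, hbB⟩] at hcx
    exact hb' hcx
  have haA' := hret ha
  rw [if_pos haA] at haA'
  exact ⟨a, b, ⟨hab, haA, hbA⟩, haA', hb'⟩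

lemma IsSeparation.edgeBoundary_tailComponent_subset_right (h : IsSeparation G A B)
    (hM : ∀ a ∈ A, f₁ a < m) (h₂ : Set.InjOn f₂ B) (hcB : c ∈ B) (hc : A ∩ B ⊆ {c})
    (hc₂ : f₂ c = 0) (hx : x ∈ V(G) \ A) :
    G.edgeBoundary (tailComponent G (glueRanking A m f₁ f₂) x) ⊆
      (G.induce B).edgeBoundary (tailComponent (G.induce B) f₂ x) := by
  have hmemB {y} (hy : y ∈ V(G)) (hyA : y ∉ A) : y ∈ B :=
    (h.union_eq.symm ▸ hy : y ∈ A ∪ B).resolve_left hyA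
  have hxB := hmemB hx.1 hx.2
  have htail {y} (hy : y ∈ tailFrom G (glueRanking A m f₁ f₂) (glueRanking A m f₁ f₂ x)) :
      y ∉ A ∧ y ∈ B ∧ f₂ x ≤ f₂ y := by
    have hle := hy.2
    rw [glueRanking_of_notMem hx.2] at hle
    have hyA : y ∉ A := fun hyA => by
      rw [glueRanking_of_mem hyA] at hle
      exact (hM y hyA).not_ge (le_of_add_le_left hle)
    rw [glueRanking_of_notMem hyA] at hle
    exact ⟨hyA, hmemB hy.1 hyA, Nat.le_of_add_le_add_left hle⟩
  rintro d ⟨a, b, hab, ha, hb⟩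
  obtain ⟨haA, haB, -⟩ := htail (tailComponent_subset hx.1 ha)
  have hbB : b ∈ B := ((h.mem_or_mem ⟨d, hab⟩).resolve_left fun h => haA h.1).2
  refine ⟨a, b, ⟨hab, haB, hbB⟩, ?_, notMem_tailComponent_of_lt hxB ?_⟩
  · refine Relation.ReflTransGen.mono ?_ _ _ ha
    rintro u v ⟨e, huv, hu, hv⟩
    exact ⟨e, ⟨huv, (htail hu).2.1, (htail hv).2.1⟩, (htail hu).2, (htail hv).2⟩
  · by_cases hbA : b ∈ A
    · obtain rfl : b = c := hc ⟨hbA, hbB⟩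
      have hne : f₂ x ≠ f₂ b := fun hxb => hx.2 (h₂ hxB hcB hxb ▸ hbA)
      omega
    · have hlt := lt_of_notMem_tailComponent hx.1 ha ⟨d, hab⟩ hb
      rw [glueRanking_of_notMem hbA, glueRanking_of_notMem hx.2] at hlt
      omega

lemma IsSeparation.exists_isRanking (h : IsSeparation G A B) (hV : V(G).Finite)
    (hE : E(G).Finite) (h₁ : IsRanking (G.induce A) f₁ k) (hr : r ∈ A) (hr₁ : f₁ r = 0)
    (h₂ : IsRanking (G.induce B) f₂ k) (hcB : c ∈ B) (hc : A ∩ B ⊆ {c}) (hc₂ : f₂ c = 0) :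
    ∃ f, IsRanking G f k ∧ f r = 0 := by
  obtain ⟨M, hM⟩ := ((hV.subset h.left_ssubset.subset).image f₁).bddAbove
  have hM (a) (ha : a ∈ A) : f₁ a < M + 1 := Nat.lt_succ_of_le (hM ⟨a, ha, rfl⟩)
  have hfin {Y} (hY : Y ⊆ V(G)) (S) : ((G.induce Y).edgeBoundary S).Finite :=
    hE.subset ((edgeBoundary_subset _ S).trans (induce_le hY).edgeSet_mono)
  refine ⟨glueRanking A (M + 1) f₁ f₂, ⟨?_, fun x hx => ?_⟩, ?_⟩
  · exact h.union_eq ▸ injOn_glueRanking hM h₁.injOn h₂.injOn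
  · by_cases hxA : x ∈ A
    · exact (Set.ncard_le_ncard (h.edgeBoundary_tailComponent_subset_left hM hxA)
        (hfin h.left_ssubset.subset _)).trans (h₁.cost_le x hxA)
    · have hxB : x ∈ B := (h.union_eq.symm ▸ hx : x ∈ A ∪ B).resolve_left hxA
      exact (Set.ncard_le_ncard
        (h.edgeBoundary_tailComponent_subset_right hM h₂.injOn hcB hc hc₂ ⟨hx, hxA⟩)
        (hfin h.right_ssubset.subset _)).trans (h₂.cost_le x hxB)
  · rw [glueRanking_of_mem hr, hr₁]

lemma exists_isTwoConnected_of_joined (hV : V(G).Finite) (hxy : G.IsLink e x y) (hne : x ≠ y)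
    (hj : (G.deleteEdges {e}).Joined x y) : ∃ H ≤ G, H.IsTwoConnected ∧ e ∈ E(H) := by
  induction G, hV using separation_induction generalizing x y with
  | base G _ hpre hcut =>
    obtain ⟨d, a, b, hd, -⟩ := exists_isLink_of_joined (S := {x}) hj rfl hne.symm
    exact ⟨G, le_rfl, ⟨hpre, hcut, d, hd.1.edge_mem, e, hxy.edge_mem, hd.2⟩, hxy.edge_mem⟩
  | glue G _ A B h ihA ihB =>
    obtain ⟨hx, hy⟩ | ⟨hx, hy⟩ := h.mem_or_mem ⟨e, hxy⟩
    · obtain ⟨H, hH, hH₂⟩ := ihA ⟨hxy, hx, hy⟩ hne (h.joined_deleteEdges_induce hx hy hj)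
      exact ⟨H, hH.trans (induce_le h.left_ssubset.subset), hH₂⟩
    · obtain ⟨H, hH, hH₂⟩ := ihB ⟨hxy, hx, hy⟩ hne (h.symm.joined_deleteEdges_induce hx hy hj)
      exact ⟨H, hH.trans (induce_le h.right_ssubset.subset), hH₂⟩

lemma exists_isRanking_of_subsingleton (hV : V(G).Finite) (hE : E(G).Subsingleton)
    (hk : ∀ e x y, G.IsLink e x y → x ≠ y → 1 ≤ k) (r : α) : ∃ f, IsRanking G f k ∧ f r = 0 := by
  obtain ⟨f, hf, hr, -⟩ := exists_injOn_refining hV (g := fun _ => 0) (r := r) rfl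
  refine ⟨f, ⟨hf, fun x _ => ?_⟩, hr⟩
  obtain h₀ | ⟨e, a, b, hab, ha, hb⟩ :=
    (G.edgeBoundary (tailComponent G f x)).eq_empty_or_nonempty
  · simp only [h₀, Set.ncard_empty, Nat.zero_le]
  · have hsub := hE.anti (edgeBoundary_subset G (tailComponent G f x))
    exact ((Set.ncard_le_one hsub.finite).2 fun _ h₁ _ h₂ => hsub h₁ h₂).trans
      (hk e a b hab fun hne => hb (hne ▸ ha))

theorem exists_isRanking_of_isTwoConnected (hV : V(G).Finite) (hE : E(G).Finite)
    (hk : ∀ e x y, G.IsLink e x y → x ≠ y → 1 ≤ k)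
    (htwo : ∀ H ≤ G, H.IsTwoConnected → ∀ r ∈ V(H), ∃ f, IsRanking H f k ∧ f r = 0)
    (hr : r ∈ V(G)) : ∃ f, IsRanking G f k ∧ f r = 0 := by
  induction G, hV using separation_induction generalizing r with
  | base G hV hpre hcut =>
    by_cases hE₂ : E(G).Nontrivial
    · exact htwo G le_rfl ⟨hpre, hcut, hE₂⟩ r hr
    · exact exists_isRanking_of_subsingleton hV (Set.not_nontrivial_iff.1 hE₂) hk r
  | glue G hV A B h ihA ihB =>
    have hA := induce_le h.left_ssubset.subset
    have hB := induce_le h.right_ssubset.subset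
    replace ihA {r} := ihA (r := r) (hE.subset hA.edgeSet_mono)
      (fun e x y hxy => hk e x y (hxy.mono hA)) (fun H hH => htwo H (hH.trans hA))
    replace ihB {r} := ihB (r := r) (hE.subset hB.edgeSet_mono)
      (fun e x y hxy => hk e x y (hxy.mono hB)) (fun H hH => htwo H (hH.trans hB))
    obtain hr | hr : r ∈ A ∪ B := h.union_eq.symm ▸ hr
    · obtain ⟨c, hcB, hc⟩ := h.exists_mem_inter_subset
      obtain ⟨f₁, h₁, hr₁⟩ := ihA hr
      obtain ⟨f₂, h₂, hc₂⟩ := ihB hcB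
      exact h.exists_isRanking hV hE h₁ hr hr₁ h₂ hcB hc hc₂
    · obtain ⟨c, hcA, hc⟩ := h.symm.exists_mem_inter_subset
      obtain ⟨f₁, h₁, hr₁⟩ := ihB hr
      obtain ⟨f₂, h₂, hc₂⟩ := ihA hcA
      exact h.symm.exists_isRanking hV hE h₁ hr hr₁ h₂ hcA hc hc₂

/-! ### Blocks -/

lemma edgeDegree_le_maxEdgeDegree (hV : V(G).Finite) (hx : x ∈ V(G)) :
    G.edgeDegree x ≤ G.maxEdgeDegree := by
  refine le_csSup (((hV.image G.edgeDegree).subset ?_).bddAbove) ⟨x, hx, rfl⟩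
  rintro _ ⟨y, hy, rfl⟩
  exact ⟨y, hy, rfl⟩

lemma maxEdgeDegree_le (h : ∀ x ∈ V(G), G.edgeDegree x ≤ k) : G.maxEdgeDegree ≤ k := by
  refine csSup_le' ?_
  rintro _ ⟨x, hx, rfl⟩
  exact h x hx

lemma one_le_maxEdgeDegree (hV : V(G).Finite) (hE : E(G).Finite) (hxy : G.IsLink e x y)
    (hne : x ≠ y) : 1 ≤ G.maxEdgeDegree :=
  calc 1 ≤ G.edgeDegree x :=
        (Set.ncard_pos (hE.subset (edgeBoundary_subset G _))).2 ⟨e, x, y, hxy, rfl, hne.symm⟩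
    _ ≤ G.maxEdgeDegree := edgeDegree_le_maxEdgeDegree hV hxy.left_mem

lemma IsRanking.one_le (hf : IsRanking G f k) (hE : E(G).Finite) (hxy : G.IsLink e x y)
    (hne : x ≠ y) : 1 ≤ k := by
  wlog hlt : f x < f y generalizing x y
  · exact this hxy.symm hne.symm
      ((not_lt.1 hlt).lt_of_ne fun h => hne (hf.injOn hxy.right_mem hxy.left_mem h).symm)
  have hmem : e ∈ G.edgeBoundary (tailComponent G f y) :=
    ⟨y, x, hxy.symm, self_mem_componentIn G _ y, notMem_tailComponent_of_lt hxy.right_mem hlt⟩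
  exact ((Set.ncard_pos (hE.subset (edgeBoundary_subset G _))).2 ⟨e, hmem⟩).trans_le
    (hf.cost_le y hxy.right_mem)

lemma banana_singleton_le (h : G.IsLink e x y) : banana x y {e} ≤ G := by
  refine ⟨?_, ?_⟩
  · rintro z (rfl | rfl)
    exacts [h.left_mem, h.right_mem]
  · rintro d a b ⟨rfl, ⟨rfl, rfl⟩ | ⟨rfl, rfl⟩⟩
    exacts [h, h.symm]

lemma le_of_isBlock (h : G.IsBlock H) : H ≤ G := by
  obtain ⟨e, x, y, -, hxy, rfl⟩ | h := h
  exacts [banana_singleton_le hxy, h.prop.1]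

lemma finite_setOf_le (hV : V(G).Finite) (hE : E(G).Finite) : {H | H ≤ G}.Finite := by
  refine Set.Finite.of_injOn (f := fun H : Graph α β => (V(H), E(H))) (t := 𝒫 V(G) ×ˢ 𝒫 E(G))
    (fun H hH => ⟨hH.vertexSet_mono, hH.edgeSet_mono⟩) (fun H hH K hK h => ?_)
    (hV.powerset.prod hE.powerset)
  rw [Prod.mk.injEq] at h
  exact Compatible.ext h.1 h.2 (Compatible.of_le_le hH hK)

lemma exists_isBlock_of_isTwoConnected (hV : V(G).Finite) (hE : E(G).Finite) (hHG : H ≤ G)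
    (hH : H.IsTwoConnected) : ∃ B, H ≤ B ∧ G.IsBlock B := by
  have hfin := (finite_setOf_le hV hE).subset
    fun K (hK : K ∈ {K : Graph α β | K ≤ G ∧ K.IsTwoConnected}) => hK.1
  obtain ⟨B, hHB, hB⟩ := hfin.exists_le_maximal ⟨hHG, hH⟩
  exact ⟨B, hHB, Or.inr hB⟩

lemma exists_isBlock_of_isLink (hV : V(G).Finite) (hE : E(G).Finite) (hxy : G.IsLink e x y)
    (hne : x ≠ y) : ∃ B, G.IsBlock B ∧ B.IsLink e x y := by
  by_cases hj : (G.deleteEdges {e}).Joined x y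
  · obtain ⟨H, hHG, hH, heH⟩ := exists_isTwoConnected_of_joined hV hxy hne hj
    obtain ⟨B, hHB, hB⟩ := exists_isBlock_of_isTwoConnected hV hE hHG hH
    exact ⟨B, hB, ((le_of_isBlock hB).isLink_iff (hHB.edgeSet_mono heH)).2 hxy⟩
  · exact ⟨banana x y {e}, Or.inl ⟨e, x, y, ⟨x, y, hxy, hj⟩, hxy, rfl⟩, rfl, Or.inl ⟨rfl, rfl⟩⟩

lemma ne_of_isBridge_of_isLink (he : G.IsBridge e) (hxy : G.IsLink e x y) : x ≠ y := by
  rintro rfl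
  obtain ⟨a, b, hab, hnj⟩ := he
  obtain ⟨rfl, rfl⟩ | ⟨rfl, rfl⟩ := hab.eq_and_eq_or_eq_and_eq hxy <;>
    exact hnj Relation.ReflTransGen.refl

lemma edgeDegree_banana_singleton_le (x y : α) (e : β) (z : α) :
    (banana x y {e}).edgeDegree z ≤ 1 :=
  (Set.ncard_le_ncard (edgeBoundary_subset _ _) (Set.finite_singleton e)).trans_eq
    (Set.ncard_singleton e)

lemma IsRanking.le_sq_of_isBlock (hf : IsRanking G f k) (hV : V(G).Finite) (hE : E(G).Finite)
    (hH : G.IsBlock H) : H.treewidth ≤ k ^ 2 ∧ H.maxEdgeDegree ≤ k ^ 2 := by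
  have hle := le_of_isBlock hH
  have hVH := hV.subset hle.vertexSet_mono
  have hEH := hE.subset hle.edgeSet_mono
  have hfH := hf.anti hE hle
  have hk : k ≤ k ^ 2 := Nat.le_self_pow two_ne_zero k
  refine ⟨(hfH.treewidth_le hVH hEH).trans hk, maxEdgeDegree_le fun z hz => ?_⟩
  obtain ⟨e, x, y, he, hxy, rfl⟩ | hmax := hH
  · exact (edgeDegree_banana_singleton_le x y e z).trans
      ((hf.one_le hE hxy (ne_of_isBridge_of_isLink he hxy)).trans hk)
  · exact hfH.edgeDegree_le hVH hEH hz (hmax.prop.2.deleteVert_preconnected z hz)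

theorem blockParameter_le_sq (hV : V(G).Finite) (hE : E(G).Finite) :
    G.blockParameter ≤ G.edgeTreewidth ^ 2 := by
  obtain ⟨f, hf⟩ := exists_isRanking_edgeTreewidth hV hE
  refine csSup_le' ?_
  rintro _ ⟨B, hB, rfl | rfl⟩
  exacts [(hf.le_sq_of_isBlock hV hE hB).1, (hf.le_sq_of_isBlock hV hE hB).2]

lemma le_blockParameter_of_isBlock (hV : V(G).Finite) (hE : E(G).Finite) (hH : G.IsBlock H) :
    H.treewidth ≤ G.blockParameter ∧ H.maxEdgeDegree ≤ G.blockParameter := by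
  have hbdd : BddAbove {n | ∃ B, G.IsBlock B ∧ (n = B.treewidth ∨ n = B.maxEdgeDegree)} := by
    have hfin := finite_setOf_le hV hE
    refine (((hfin.image treewidth).union (hfin.image maxEdgeDegree)).subset ?_).bddAbove
    rintro _ ⟨B, hB, rfl | rfl⟩
    exacts [Or.inl ⟨B, le_of_isBlock hB, rfl⟩, Or.inr ⟨B, le_of_isBlock hB, rfl⟩]
  exact ⟨le_csSup hbdd ⟨H, hH, Or.inl rfl⟩, le_csSup hbdd ⟨H, hH, Or.inr rfl⟩⟩

lemma one_le_blockParameter (hV : V(G).Finite) (hE : E(G).Finite) (hxy : G.IsLink e x y)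
    (hne : x ≠ y) : 1 ≤ G.blockParameter := by
  obtain ⟨B, hB, hxyB⟩ := exists_isBlock_of_isLink hV hE hxy hne
  have hle := le_of_isBlock hB
  exact (one_le_maxEdgeDegree (hV.subset hle.vertexSet_mono) (hE.subset hle.edgeSet_mono) hxyB
    hne).trans (le_blockParameter_of_isBlock hV hE hB).2

lemma exists_isRanking_of_le_isBlock (hV : V(G).Finite) (hE : E(G).Finite) {B : Graph α β}
    (hB : G.IsBlock B) (hHB : H ≤ B) (hr : r ∈ V(H)) :
    ∃ f, IsRanking H f (G.blockParameter * G.blockParameter) ∧ f r = 0 := by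
  have hle := le_of_isBlock hB
  have hVB := hV.subset hle.vertexSet_mono
  have hEB := hE.subset hle.edgeSet_mono
  obtain ⟨htw, hdeg⟩ := le_blockParameter_of_isBlock hV hE hB
  obtain ⟨D, hD⟩ := exists_treeDecomposition_treewidth hVB hEB
  obtain ⟨f, hf, hr⟩ := exists_isRanking_of_treeDecomposition hVB hEB D
    (fun t => (hD t).trans (Nat.add_le_add_right htw 1))
    (fun x hx => (edgeDegree_le_maxEdgeDegree hVB hx).trans hdeg) (hHB.vertexSet_mono hr)
  exact ⟨f, hf.anti hEB hHB, hr⟩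

theorem edgeTreewidth_le_sq (hV : V(G).Finite) (hE : E(G).Finite) :
    G.edgeTreewidth ≤ G.blockParameter ^ 2 := by
  rw [sq]
  obtain h₀ | ⟨r, hr⟩ := V(G).eq_empty_or_nonempty
  · have hf : IsRanking G (fun _ => 0) (G.blockParameter * G.blockParameter) :=
      ⟨by simp only [h₀, Set.injOn_empty], fun x hx => absurd (h₀ ▸ hx) (Set.notMem_empty x)⟩
    exact hf.edgeTreewidth_le hV
  · have hone (e x y) (hxy : G.IsLink e x y) (hne : x ≠ y) :
        1 ≤ G.blockParameter * G.blockParameter :=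
      Nat.mul_pos (one_le_blockParameter hV hE hxy hne) (one_le_blockParameter hV hE hxy hne)
    have htwo (H) (hHG : H ≤ G) (hH : H.IsTwoConnected) (r) (hr : r ∈ V(H)) :
        ∃ f, IsRanking H f (G.blockParameter * G.blockParameter) ∧ f r = 0 := by
      obtain ⟨B, hHB, hB⟩ := exists_isBlock_of_isTwoConnected hV hE hHG hH
      exact exists_isRanking_of_le_isBlock hV hE hB hHB hr
    obtain ⟨f, hf, -⟩ := exists_isRanking_of_isTwoConnected hV hE hone htwo hr
    exact hf.edgeTreewidth_le hV

end EdgeTreewidth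

theorem mainTheorem2_general {α : Type u} {β : Type v} (G : Graph α β)
    (hV : G.vertexSet.Finite) (hE : G.edgeSet.Finite) :
    G.blockParameter ≤ G.edgeTreewidth ^ 2 ∧ G.edgeTreewidth ≤ G.blockParameter ^ 2 :=
  ⟨EdgeTreewidth.blockParameter_le_sq hV hE, EdgeTreewidth.edgeTreewidth_le_sq hV hE⟩

theorem mainTheorem2 :
    GraphParameter.ParametricallyEquivalent.{u, v}
      (fun _ _ G => G.edgeTreewidth) (fun _ _ G => G.blockParameter) ∧
    ∀ (α : Type u) (β : Type v) (G : Graph α β),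
      G.vertexSet.Finite → G.edgeSet.Finite → G.Loopless →
        Real.sqrt (G.blockParameter : ℝ) ≤ (G.edgeTreewidth : ℝ) ∧
        G.edgeTreewidth ≤ G.blockParameter ^ 4 + 2 * G.blockParameter ^ 2 := by
  refine ⟨⟨⟨(· ^ 2), fun _ _ G hV hE _ => (mainTheorem2_general G hV hE).1⟩,
    ⟨(· ^ 2), fun _ _ G hV hE _ => (mainTheorem2_general G hV hE).2⟩⟩, fun _ _ G hV hE _ => ?_⟩
  obtain ⟨hblock, hlayout⟩ := mainTheorem2_general G hV hE
  refine ⟨?_, by omega⟩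
  rw [Real.sqrt_le_left (Nat.cast_nonneg _)]
  exact_mod_cast hblock
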